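/- A \emph{numerical semigroup} is a subset $\Lambda\subseteq\mathbb{N}_0$ that contains $0$, is closed under addition and has finite complement. Its \emph{genus} is the number of elements of $\mathbb{N}_0\setminus\Lambda$, its \emph{multiplicity} is its smallest nonzero element, and its \emph{conductor} $c(\Lambda)$ is the least $c\in\mathbb{N}_0$ such that all integers $n\ge c$ belong to $\Lambda$. A \emph{minimal generator} of $\Lambda$ is a nonzero element of $\Lambda$ that is not the sum of two nonzero elements of $\Lambda$; it is an \emph{effective generator} if it is at least $c(\Lambda)$. The \emph{children} of $\Lambda$ are the numerical semigroups $\Lambda\setminus\{x\}$ with $x$ an effective generator of $\Lambda$, and $\Lambda$ is the \emph{parent} of each of them. An \emph{infinite chain} is a set $\{\Lambda_0,\Lambda_1,\Lambda_2,\dots\}$ of numerical semigroups such that $\Lambda_i$ is the parent of $\Lambda_{i+1}$ for all $i\ge 0$. \textbf{Theorem.} For every integer $g\ge 0$, the number $i_g(6)$ of numerical semigroups of genus $g$ and multiplicity $6$ that are in an infinite chain is finite and equals $$i_g(6)=\begin{cases} 0 & \text{if } g\le 4,\\ 1 & \text{if } g=5,\\ g-5 & \text{if } 5<g\le 15 \text{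 and } (g \bmod 5)\le 2,\\ g-4 & \text{if } 5<g\le 15 \text{ and } (g \bmod 5)>2,\\ g-5+\Sigma(g) & \text{if } g\ge 16 \text{ and } (g \bmod 5)\le 2,\\ g-4+\Sigma(g) & \text{if } g\ge 16 \text{ and } (g \bmod 5)>2, \end{cases}$$ where $$\Sigma(g)=\sum_{n=1}^{\lfloor\frac{g-11}{9}\rfloor}n+\sum_{n=1}^{\lfloor\frac{g-8}{9}\rfloor}n+\sum_{n=\lfloor\frac{g-2}{9}\rfloor}^{\lfloor\frac{g-15}{5}\rfloor}\left\lfloor\frac{g-11-5n}{4}\right\rfloor+\sum_{n=\lfloor\frac{g+1}{9}\rfloor}^{\lfloor\frac{g-12}{5}\rfloor}\left\lfloor\frac{g-8-5n}{4}\right\rfloor,$$ and a sum whose lower limit exceeds its upper limit is $0$. -/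

import Mathlib

/-- A numerical semigroup: a set of natural numbers that contains `0`, is closed under addition
and has finite complement. -/
@[ext]
structure NumericalSemigroup extends AddSubmonoid ℕ where
  finite_gaps : ((carrier)ᶜ).Finite

namespace NumericalSemigroup

/-- The underlying set of non-gaps. -/
def nongaps (Λ : NumericalSemigroup) : Set ℕ := Λ.carrier

/-- The genus: the number of gaps. -/
noncomputable def genus (Λ : NumericalSemigroup) : ℕ := (Λ.nongapsᶜ).ncard

/-- The multiplicity: the smallest nonzero element. -/
noncomputable def multiplicity (Λ : NumericalSemigroup) : ℕ := sInf {x | x ∈ Λ.nongaps ∧ x ≠ 0}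

/-- The conductor: the smallest `c` such that every integer `n ≥ c` belongs to the semigroup. -/
noncomputable def conductor (Λ : NumericalSemigroup) : ℕ := sInf {c | ∀ n, c ≤ n → n ∈ Λ.nongaps}

/-- The minimal system of generators: the nonzero elements of the semigroup that are not the sum
of two nonzero elements of the semigroup. -/
def minimalGenerators (Λ : NumericalSemigroup) : Set ℕ :=
  {x | x ∈ Λ.nongaps ∧ x ≠ 0 ∧
    ∀ a ∈ Λ.nongaps, ∀ b ∈ Λ.nongaps, a ≠ 0 → b ≠ 0 → a + b ≠ x}

/-- The effective (or right) generators: the minimal generators that are not left elements,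
i.e. that are not smaller than the conductor. -/
def effectiveGenerators (Λ : NumericalSemigroup) : Set ℕ :=
  {x | x ∈ Λ.minimalGenerators ∧ Λ.conductor ≤ x}

/-- `P.IsParent C`: in the semigroup tree `C` is a child of `P`, i.e. `C` is obtained from `P`
by taking away one effective generator. -/
def IsParent (P C : NumericalSemigroup) : Prop :=
  ∃ x ∈ P.effectiveGenerators, C.nongaps = P.nongaps \ {x}

/-- An infinite chain: a set of numerical semigroups that can be enumerated as
`Λ₀, Λ₁, Λ₂, …` with each `Λᵢ` the parent of `Λᵢ₊₁`. (Such a set is automatically infinite, since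
the genus increases by one at each step.) -/
def IsInfiniteChain (I : Set NumericalSemigroup) : Prop :=
  ∃ s : ℕ → NumericalSemigroup, (∀ i, (s i).IsParent (s (i + 1))) ∧ Set.range s = I

/-- The numerical semigroups of genus `g` and multiplicity `m` that are in an infinite chain. -/
def chainSemigroups (m g : ℕ) : Set NumericalSemigroup :=
  {Λ | Λ.genus = g ∧ Λ.multiplicity = m ∧ ∃ I, IsInfiniteChain I ∧ Λ ∈ I}

/-- The number `i_g(m)` of numerical semigroups of genus `g` and multiplicity `m` that are in an
infinite chain. -/
noncomputable def chainCount (m g : ℕ) : ℕ := (chainSemigroups m g).ncard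

end NumericalSemigroup

/-- The four floor sums of the formula for multiplicity six. Division of integers by a positive
integer is the floor of the quotient, and a sum over an empty interval is zero. -/
noncomputable def sixFloorSums (g : ℤ) : ℤ :=
  (∑ n ∈ Finset.Icc 1 ((g - 11) / 9), n)
    + (∑ n ∈ Finset.Icc 1 ((g - 8) / 9), n)
    + (∑ n ∈ Finset.Icc ((g - 2) / 9) ((g - 15) / 5), (g - 11 - 5 * n) / 4)
    + (∑ n ∈ Finset.Icc ((g + 1) / 9) ((g - 12) / 5), (g - 8 - 5 * n) / 4)

/-! ### Infinite chains and common divisors -/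

namespace NumericalSemigroup

/-! A semigroup lies in an infinite chain iff its elements below the conductor share a divisor `d ≠
1` (`exists_infiniteChain_iff`): along a chain, the gcd of the elements never removed is such a `d`;
conversely one keeps removing the least non-multiple of `d`. For multiplicity 6 it suffices to take
`d = 2` or `d = 3`, so the count is N₂ + N₃ − N₆ by inclusion–exclusion (`chainCount_six_add`).

In Kunz coordinates the condition for `d` says that the Apéry elements in classes prime to `d`
exceed every largest gap of a class. The coordinates of the classes not divisible by `d` are then as
equal as possible, hence fixed by their sum. This gives N₆ = 1, N₃ = ⌊(g+2)/5⌋, and N₂ as a count of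
lattice points (x, y) in a polygon (`kunzTuples_two_eq`). Slicing the polygon by min(x, y) gives
sums of minima (`card_evenPairs`); splitting each minimum at its crossing point yields the four
floor sums (`sixFloorSums_eq`). -/

theorem zero_mem_nongaps (Λ : NumericalSemigroup) : 0 ∈ Λ.nongaps := Λ.zero_mem'

theorem add_mem_nongaps (Λ : NumericalSemigroup) {a b : ℕ} (ha : a ∈ Λ.nongaps)
    (hb : b ∈ Λ.nongaps) : a + b ∈ Λ.nongaps := Λ.add_mem' ha hb

theorem nongaps_injective : Function.Injective nongaps := fun _ _ h => NumericalSemigroup.ext h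

theorem exists_forall_ge_mem (Λ : NumericalSemigroup) : ∃ c, ∀ n, c ≤ n → n ∈ Λ.nongaps := by
  obtain ⟨b, hb⟩ := Λ.finite_gaps.bddAbove
  refine ⟨b + 1, fun n hn => ?_⟩
  by_contra h
  have := hb (show n ∈ (Λ.carrier)ᶜ from h)
  omega

theorem mem_of_conductor_le (Λ : NumericalSemigroup) {n : ℕ} (h : Λ.conductor ≤ n) :
    n ∈ Λ.nongaps :=
  Nat.sInf_mem (s := {c | ∀ n, c ≤ n → n ∈ Λ.nongaps}) Λ.exists_forall_ge_mem n h

theorem conductor_le {Λ : NumericalSemigroup} {c : ℕ} (h : ∀ n, c ≤ n → n ∈ Λ.nongaps) :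
    Λ.conductor ≤ c := Nat.sInf_le h

/-- Every element that is not a multiple of `d` is at least the conductor. -/
def MultiplesBelowConductor (d : ℕ) (Λ : NumericalSemigroup) : Prop :=
  ∀ x ∈ Λ.nongaps, ¬ d ∣ x → ∀ y, x ≤ y → y ∈ Λ.nongaps

theorem MultiplesBelowConductor.of_dvd {d e : ℕ} {Λ : NumericalSemigroup}
    (h : Λ.MultiplesBelowConductor d) (hed : e ∣ d) : Λ.MultiplesBelowConductor e :=
  fun x hx hx' => h x hx fun hd => hx' (hed.trans hd)

/-- The semigroup obtained by taking away a minimal generator. -/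
def erase (Λ : NumericalSemigroup) (x : ℕ) (hx : x ∈ Λ.minimalGenerators) :
    NumericalSemigroup where
  carrier := Λ.nongaps \ {x}
  zero_mem' := ⟨Λ.zero_mem_nongaps, fun h => hx.2.1 h.symm⟩
  add_mem' := by
    rintro a b ⟨ha, hax⟩ ⟨hb, hbx⟩
    refine ⟨Λ.add_mem_nongaps ha hb, fun h => ?_⟩
    rw [Set.mem_singleton_iff] at h hax hbx
    by_cases ha0 : a = 0
    · exact hbx (by omega)
    by_cases hb0 : b = 0
    · exact hax (by omega)
    exact hx.2.2 a ha b hb ha0 hb0 h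
  finite_gaps := by
    refine (Λ.finite_gaps.union (Set.finite_singleton x)).subset fun y hy => ?_
    by_contra h
    rw [Set.mem_union, not_or] at h
    exact hy ⟨not_not.1 h.1, h.2⟩

/-- The least non-multiple of `d` is a minimal generator, since smaller elements are multiples of
`d` and so are their sums; the hypothesis makes it effective. -/
theorem MultiplesBelowConductor.exists_child {d : ℕ} (hd : d ≠ 1) {Λ : NumericalSemigroup}
    (h : Λ.MultiplesBelowConductor d) :
    ∃ C, Λ.IsParent C ∧ C.MultiplesBelowConductor d := by
  have hex : ∃ x, x ∈ Λ.nongaps ∧ ¬ d ∣ x := by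
    obtain ⟨c, hc⟩ := Λ.exists_forall_ge_mem
    by_contra! hall
    have h1 := hall c (hc c le_rfl)
    have h2 := hall (c + 1) (hc (c + 1) (by omega))
    exact hd (Nat.dvd_one.1 ((Nat.dvd_add_right h1).1 h2))
  classical
  obtain ⟨x, ⟨hx, hdx⟩, hmin⟩ : ∃ x, (x ∈ Λ.nongaps ∧ ¬ d ∣ x) ∧
      ∀ y ∈ Λ.nongaps, y < x → d ∣ y :=
    ⟨Nat.find hex, Nat.find_spec hex, fun y hy hlt => by
      have := Nat.find_min hex hlt
      tauto⟩
  have hgen : x ∈ Λ.minimalGenerators := by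
    refine ⟨hx, fun h0 => hdx (h0 ▸ dvd_zero d), fun a ha b hb ha0 hb0 hab => hdx ?_⟩
    rw [← hab]
    exact dvd_add (hmin a ha (by omega)) (hmin b hb (by omega))
  refine ⟨Λ.erase x hgen, ⟨x, ⟨hgen, conductor_le (h x hx hdx)⟩, rfl⟩, ?_⟩
  rintro y ⟨hy, hyx⟩ hdy z hyz
  rw [Set.mem_singleton_iff] at hyx
  have : ¬ y < x := fun hlt => hdy (hmin y hy hlt)
  exact ⟨h y hy hdy z hyz, fun hz => by rw [Set.mem_singleton_iff] at hz; omega⟩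

theorem MultiplesBelowConductor.exists_chain {d : ℕ} (hd : d ≠ 1) {Λ : NumericalSemigroup}
    (h : Λ.MultiplesBelowConductor d) : ∃ I, IsInfiniteChain I ∧ Λ ∈ I := by
  choose f hf using fun P : {P : NumericalSemigroup // P.MultiplesBelowConductor d} =>
    P.2.exists_child hd
  let next : {P : NumericalSemigroup // P.MultiplesBelowConductor d} →
    {P : NumericalSemigroup // P.MultiplesBelowConductor d} := fun P => ⟨f P, (hf P).2⟩
  refine ⟨_, ⟨fun i => (next^[i] ⟨Λ, h⟩).1, fun i => ?_, rfl⟩, 0, rfl⟩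
  simp only [Function.iterate_succ_apply']
  exact (hf _).1

/-- The removed elements `x i` increase strictly, and `d` is the gcd of the elements that survive
forever. It may be `0`, when only `0` survives. -/
theorem exists_multiplesBelowConductor_of_chain {s : ℕ → NumericalSemigroup}
    (hs : ∀ i, (s i).IsParent (s (i + 1))) : ∃ d, d ≠ 1 ∧ (s 0).MultiplesBelowConductor d := by
  choose x hx hsucc using hs
  have hcond : ∀ i, x i + 1 ≤ (s (i + 1)).conductor := fun i => by
    by_contra! hlt
    have : x i ∈ (s (i + 1)).nongaps := mem_of_conductor_le _ (by omega)
    rw [hsucc] at this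
    exact this.2 rfl
  have hxmono : StrictMono x := strictMono_nat_of_lt_succ fun i =>
    (hcond i).trans (hx (i + 1)).2
  have hmem : ∀ y ∈ (s 0).nongaps, (∀ i, y ≠ x i) → ∀ i, y ∈ (s i).nongaps := by
    intro y hy hne i
    induction i with
    | zero => exact hy
    | succ i ih => rw [hsucc]; exact ⟨ih, hne i⟩
  refine ⟨Nat.setGcd {y | ∀ i, y ∈ (s i).nongaps}, fun hone => ?_, fun y hy hdvd z hyz => ?_⟩
  -- If the gcd were 1, the survivors would generate every large integer, including some removed `x
  -- n`.
  · obtain ⟨n, hn⟩ := Nat.exists_mem_closure_of_ge {y | ∀ i, y ∈ (s i).nongaps}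
    have hclosure : AddSubmonoid.closure {y | ∀ i, y ∈ (s i).nongaps}
        ≤ (s (n + 1)).toAddSubmonoid := AddSubmonoid.closure_le.2 fun y hy => hy (n + 1)
    have : x n ∈ (s (n + 1)).nongaps :=
      hclosure (hn (x n) (hxmono.id_le n) (hone ▸ one_dvd _))
    rw [hsucc] at this
    exact this.2 rfl
  · have : ∃ i, y = x i := by
      by_contra! hne
      exact hdvd (Nat.setGcd_dvd_of_mem (hmem y hy hne))
    obtain ⟨i, rfl⟩ := this
    exact mem_of_conductor_le _
      (((hx 0).2.trans (hxmono.monotone (Nat.zero_le i))).trans hyz)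

/-- A numerical semigroup lies in an infinite chain exactly when its elements below the conductor
have a greatest common divisor different from `1`. -/
theorem exists_infiniteChain_iff {Λ : NumericalSemigroup} :
    (∃ I, IsInfiniteChain I ∧ Λ ∈ I) ↔ ∃ d, d ≠ 1 ∧ Λ.MultiplesBelowConductor d := by
  constructor
  · rintro ⟨_, ⟨s, hs, rfl⟩, i, rfl⟩
    exact exists_multiplesBelowConductor_of_chain (s := fun j => s (i + j)) fun j => hs (i + j)
  · rintro ⟨d, hd, h⟩
    exact h.exists_chain hd

theorem multiplicity_mem (Λ : NumericalSemigroup) :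
    Λ.multiplicity ∈ Λ.nongaps ∧ Λ.multiplicity ≠ 0 := by
  obtain ⟨c, hc⟩ := Λ.exists_forall_ge_mem
  exact Nat.sInf_mem (s := {x | x ∈ Λ.nongaps ∧ x ≠ 0}) ⟨c + 1, hc _ (by omega), by omega⟩

theorem multiplicity_le {Λ : NumericalSemigroup} {x : ℕ} (hx : x ∈ Λ.nongaps) (h0 : x ≠ 0) :
    Λ.multiplicity ≤ x := Nat.sInf_le (s := {x | x ∈ Λ.nongaps ∧ x ≠ 0}) ⟨hx, h0⟩

theorem exists_infiniteChain_iff_of_multiplicity_eq_six {Λ : NumericalSemigroup}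
    (hm : Λ.multiplicity = 6) : (∃ I, IsInfiniteChain I ∧ Λ ∈ I) ↔
      Λ.MultiplesBelowConductor 2 ∨ Λ.MultiplesBelowConductor 3 := by
  rw [exists_infiniteChain_iff]
  constructor
  · rintro ⟨d, hd, h⟩
    by_cases hd6 : d ∣ 6
    · have : d ≤ 6 := Nat.le_of_dvd (by norm_num) hd6
      have : 2 ∣ d ∨ 3 ∣ d := by
        interval_cases d <;> omega
      exact this.imp h.of_dvd h.of_dvd
    -- Here 6 is not a multiple of `d`, so everything from 6 on belongs to `Λ`.
    · left
      intro x hx hx2 y hxy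
      refine h 6 (hm ▸ Λ.multiplicity_mem.1) hd6 y (le_trans ?_ hxy)
      exact hm ▸ multiplicity_le hx fun h0 => hx2 (h0 ▸ dvd_zero 2)
  · rintro (h | h)
    · exact ⟨2, by norm_num, h⟩
    · exact ⟨3, by norm_num, h⟩

end NumericalSemigroup

/-! ### Kunz coordinates -/

namespace NumericalSemigroup

/-- The least `q` such that `6 * q + i` is in the semigroup. -/
noncomputable def kunz (Λ : NumericalSemigroup) (i : Fin 6) : ℕ := sInf {q | 6 * q + i ∈ Λ.nongaps}

theorem kunz_mem (Λ : NumericalSemigroup) (i : Fin 6) : 6 * Λ.kunz i + i ∈ Λ.nongaps := by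
  obtain ⟨c, hc⟩ := Λ.exists_forall_ge_mem
  exact Nat.sInf_mem (s := {q | 6 * q + i ∈ Λ.nongaps})
    ⟨c, hc _ (by omega)⟩

theorem mul_six_mem {Λ : NumericalSemigroup} (h6 : 6 ∈ Λ.nongaps) (n : ℕ) :
    6 * n ∈ Λ.nongaps := by
  induction n with
  | zero => exact Λ.zero_mem_nongaps
  | succ n ih => exact Λ.add_mem_nongaps ih h6

theorem mul_six_add_mem_iff {Λ : NumericalSemigroup} (h6 : 6 ∈ Λ.nongaps) (q : ℕ) (i : Fin 6) :
    6 * q + i ∈ Λ.nongaps ↔ Λ.kunz i ≤ q := by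
  constructor
  · exact fun h => Nat.sInf_le (s := {q | 6 * q + i ∈ Λ.nongaps}) h
  · intro h
    have := Λ.add_mem_nongaps (Λ.kunz_mem i) (mul_six_mem h6 (q - Λ.kunz i))
    convert this using 1
    omega

theorem mem_iff_kunz_le {Λ : NumericalSemigroup} (h6 : 6 ∈ Λ.nongaps) (x : ℕ) :
    x ∈ Λ.nongaps ↔ Λ.kunz (Fin.ofNat 6 x) ≤ x / 6 := by
  rw [← mul_six_add_mem_iff h6, Fin.val_ofNat, Nat.div_add_mod]

theorem kunz_injOn : Set.InjOn kunz {Λ | 6 ∈ Λ.nongaps} := by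
  intro Λ h Λ' h' heq
  apply nongaps_injective
  ext x
  rw [mem_iff_kunz_le h, mem_iff_kunz_le h', heq]

theorem genus_eq_sum_kunz {Λ : NumericalSemigroup} (h6 : 6 ∈ Λ.nongaps) :
    Λ.genus = ∑ i, Λ.kunz i := by
  have : Λ.nongapsᶜ = ↑((Finset.univ.sigma fun i => Finset.range (Λ.kunz i)).image
      fun p : (_ : Fin 6) × ℕ => 6 * p.2 + p.1) := by
    ext x
    simp only [Set.mem_compl_iff, mem_iff_kunz_le h6, not_le, Finset.coe_image, Set.mem_image,
      Finset.mem_coe, Finset.mem_sigma, Finset.mem_univ, true_and, Finset.mem_range]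
    constructor
    · exact fun h => ⟨⟨Fin.ofNat 6 x, x / 6⟩, h, Nat.div_add_mod x 6⟩
    · rintro ⟨⟨i, q⟩, hq, rfl⟩
      have h1 : Fin.ofNat 6 (6 * q + i) = i := by
        ext; simp only [Fin.val_ofNat]; omega
      have h2 : (6 * q + (i : ℕ)) / 6 = q := by omega
      rw [h1, h2]
      exact hq
  rw [genus, this, Set.ncard_coe_finset, Finset.card_image_of_injective]
  · simp
  · rintro ⟨i, q⟩ ⟨j, r⟩ h
    simp only at h
    obtain rfl : i = j := by ext; omega
    obtain rfl : q = r := by omega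
    rfl

theorem multiplicity_eq_six_iff {Λ : NumericalSemigroup} :
    Λ.multiplicity = 6 ↔ 6 ∈ Λ.nongaps ∧ ∀ i, i ≠ 0 → Λ.kunz i ≠ 0 := by
  constructor
  · intro h
    refine ⟨h ▸ Λ.multiplicity_mem.1, fun i hi h0 => ?_⟩
    have hmem := Λ.kunz_mem i
    rw [h0, mul_zero, zero_add] at hmem
    have := multiplicity_le hmem (Fin.val_ne_zero_iff.2 hi)
    omega
  · rintro ⟨h6, h⟩
    refine le_antisymm (multiplicity_le h6 (by norm_num)) ?_
    by_contra! hlt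
    obtain ⟨hmem, h0⟩ := Λ.multiplicity_mem
    have := (mul_six_add_mem_iff h6 0 ⟨Λ.multiplicity, hlt⟩).1 (by simpa using hmem)
    exact h _ (fun h => h0 (congrArg Fin.val h)) (Nat.le_zero.1 this)

/-- It is enough to compare the least element of each class not divisible by `d` with the largest
gap `6 * (k j - 1) + j` of each class. -/
theorem multiplesBelowConductor_iff_kunz {d : ℕ} {Λ : NumericalSemigroup} (hd : d ∣ 6)
    (h6 : 6 ∈ Λ.nongaps) : Λ.MultiplesBelowConductor d ↔
      ∀ i j : Fin 6, ¬ d ∣ i → 6 * Λ.kunz j + j < 6 * Λ.kunz i + i + 6 := by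
  constructor
  · intro h i j hi
    by_contra! hle
    have := h _ (Λ.kunz_mem i)
      (fun hdvd => hi ((Nat.dvd_add_right (hd.mul_right _)).1 hdvd))
      (6 * (Λ.kunz j - 1) + j) (by omega)
    rw [mul_six_add_mem_iff h6] at this
    omega
  · intro h x hx hdx y hxy
    rw [mem_iff_kunz_le h6] at hx ⊢
    have hx' : ¬ d ∣ ((Fin.ofNat 6 x : Fin 6) : ℕ) := by
      rw [Fin.val_ofNat]
      exact fun hdvd => hdx ((Nat.dvd_mod_iff hd).1 hdvd)
    have := h (Fin.ofNat 6 x) (Fin.ofNat 6 y) hx'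
    simp only [Fin.val_ofNat] at this
    omega

/-- The semigroup with given Kunz coordinates. -/
def ofKunz (k : Fin 6 → ℕ) (h0 : k 0 = 0)
    (hadd : ∀ i j : Fin 6, k (i + j) ≤ k i + k j + ((i : ℕ) + j) / 6) : NumericalSemigroup where
  carrier := {x | k (Fin.ofNat 6 x) ≤ x / 6}
  zero_mem' := by simpa using h0
  add_mem' := by
    intro a b ha hb
    simp only [Set.mem_ofPred_eq] at ha hb ⊢
    have h := hadd (Fin.ofNat 6 a) (Fin.ofNat 6 b)
    have hab : Fin.ofNat 6 a + Fin.ofNat 6 b = Fin.ofNat 6 (a + b) := by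
      ext; simp [Fin.val_add]
    rw [hab] at h
    simp only [Fin.val_ofNat] at h
    omega
  finite_gaps := by
    refine (Set.finite_Iio (6 * ∑ i, k i)).subset fun x hx => ?_
    simp only [Set.mem_compl_iff, Set.mem_ofPred_eq, not_le] at hx
    have := Finset.single_le_sum (f := k) (fun i _ => Nat.zero_le _)
      (Finset.mem_univ (Fin.ofNat 6 x))
    rw [Set.mem_Iio]
    omega

theorem mem_ofKunz {k : Fin 6 → ℕ} {h0 hadd} (q : ℕ) (i : Fin 6) :
    6 * q + i ∈ (ofKunz k h0 hadd).nongaps ↔ k i ≤ q := by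
  have h1 : Fin.ofNat 6 (6 * q + i) = i := by
    ext; simp only [Fin.val_ofNat]; omega
  have h2 : (6 * q + (i : ℕ)) / 6 = q := by omega
  change k (Fin.ofNat 6 (6 * q + i)) ≤ (6 * q + (i : ℕ)) / 6 ↔ _
  rw [h1, h2]

theorem kunz_ofKunz {k : Fin 6 → ℕ} {h0 hadd} : (ofKunz k h0 hadd).kunz = k := by
  ext i
  simp only [kunz, mem_ofKunz]
  exact csInf_Ici

/-- The Kunz coordinates of the semigroups of genus `g` and multiplicity `6` all of whose elements
below the conductor are multiples of `d`. -/
def kunzTuples (d g : ℕ) : Set (Fin 6 → ℕ) :=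
  {k | k 0 = 0 ∧ (∀ i, i ≠ 0 → k i ≠ 0) ∧
    (∀ i j : Fin 6, k (i + j) ≤ k i + k j + ((i : ℕ) + j) / 6) ∧ ∑ i, k i = g ∧
    ∀ i j : Fin 6, ¬ d ∣ i → 6 * k j + j < 6 * k i + i + 6}

theorem bijOn_kunz {d : ℕ} (hd : d ∣ 6) (g : ℕ) : Set.BijOn kunz
    {Λ | Λ.genus = g ∧ Λ.multiplicity = 6 ∧ Λ.MultiplesBelowConductor d} (kunzTuples d g) := by
  refine ⟨?_, kunz_injOn.mono fun Λ h => (multiplicity_eq_six_iff.1 h.2.1).1, ?_⟩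
  · rintro Λ ⟨hg, hm, h⟩
    obtain ⟨h6, hne⟩ := multiplicity_eq_six_iff.1 hm
    refine ⟨?_, hne, fun i j => ?_, (genus_eq_sum_kunz h6).symm.trans hg,
      (multiplesBelowConductor_iff_kunz hd h6).1 h⟩
    · exact Nat.le_zero.1 ((mul_six_add_mem_iff h6 0 0).1 (by simpa using Λ.zero_mem_nongaps))
    · rw [← mul_six_add_mem_iff h6]
      convert Λ.add_mem_nongaps (Λ.kunz_mem i) (Λ.kunz_mem j) using 1
      rw [Fin.val_add]
      omega
  · rintro k ⟨h0, hne, hadd, hg, h⟩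
    have h6 : 6 ∈ (ofKunz k h0 hadd).nongaps := (mem_ofKunz 1 0).2 (by omega)
    refine ⟨ofKunz k h0 hadd, ⟨?_, ?_, ?_⟩, kunz_ofKunz⟩
    · rw [genus_eq_sum_kunz h6, kunz_ofKunz, hg]
    · rw [multiplicity_eq_six_iff, kunz_ofKunz]
      exact ⟨h6, hne⟩
    · rw [multiplesBelowConductor_iff_kunz hd h6, kunz_ofKunz]
      exact h

theorem finite_kunzTuples (d g : ℕ) : (kunzTuples d g).Finite := by
  refine (Set.finite_Iic fun _ => g).subset fun k hk i => ?_
  rw [← hk.2.2.2.1]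
  exact Finset.single_le_sum (f := k) (fun i _ => Nat.zero_le _) (Finset.mem_univ i)

theorem chainSemigroups_six_eq (g : ℕ) : chainSemigroups 6 g =
    {Λ | Λ.genus = g ∧ Λ.multiplicity = 6 ∧ Λ.MultiplesBelowConductor 2} ∪
    {Λ | Λ.genus = g ∧ Λ.multiplicity = 6 ∧ Λ.MultiplesBelowConductor 3} := by
  ext Λ
  simp only [chainSemigroups, Set.mem_ofPred_eq, Set.mem_union, ← and_or_left]
  refine and_congr_right fun _ => and_congr_right fun hm => ?_
  exact exists_infiniteChain_iff_of_multiplicity_eq_six hm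

theorem finite_chainSemigroups_six (g : ℕ) : (chainSemigroups 6 g).Finite := by
  rw [chainSemigroups_six_eq]
  exact ((bijOn_kunz (by norm_num) g).finite_iff_finite.2 (finite_kunzTuples 2 g)).union
    ((bijOn_kunz (by norm_num) g).finite_iff_finite.2 (finite_kunzTuples 3 g))

theorem chainCount_six_add (g : ℕ) : chainCount 6 g + (kunzTuples 6 g).ncard =
    (kunzTuples 2 g).ncard + (kunzTuples 3 g).ncard := by
  have h2 := bijOn_kunz (d := 2) (by norm_num) g
  have h3 := bijOn_kunz (d := 3) (by norm_num) g
  rw [← h2.ncard_eq, ← h3.ncard_eq, ← (bijOn_kunz (d := 6) dvd_rfl g).ncard_eq,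
    ← Set.ncard_union_add_ncard_inter _ _ (h2.finite_iff_finite.2 (finite_kunzTuples 2 g))
      (h3.finite_iff_finite.2 (finite_kunzTuples 3 g)), chainCount, chainSemigroups_six_eq]
  congr 2
  ext Λ
  simp only [Set.mem_ofPred_eq, Set.mem_inter_iff]
  constructor
  · rintro ⟨hg, hm, h⟩
    exact ⟨⟨hg, hm, h.of_dvd (by norm_num)⟩, hg, hm, h.of_dvd (by norm_num)⟩
  · rintro ⟨⟨hg, hm, h⟩, -, -, h'⟩
    refine ⟨hg, hm, fun x hx hx6 => ?_⟩
    by_cases hx2 : 2 ∣ x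
    · exact h' x hx (by omega)
    · exact h x hx hx2

end NumericalSemigroup

/-! ### The tuples for `d = 2, 3, 6` -/

namespace NumericalSemigroup

theorem mem_kunzTuples_iff {d g : ℕ} (a b c e f : ℕ) :
    ![0, a, b, c, e, f] ∈ kunzTuples d g ↔
      (a ≠ 0 ∧ b ≠ 0 ∧ c ≠ 0 ∧ e ≠ 0 ∧ f ≠ 0) ∧
      (b ≤ a + a ∧ c ≤ a + b ∧ e ≤ a + c ∧ f ≤ a + e ∧ e ≤ b + b ∧ f ≤ b + c ∧
        a ≤ b + f + 1 ∧ a ≤ c + e + 1 ∧ b ≤ c + f + 1 ∧ b ≤ e + e + 1 ∧ c ≤ e + f + 1 ∧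
        e ≤ f + f + 1) ∧
      a + b + c + e + f = g ∧
      ∀ i j : Fin 6, ¬ d ∣ i →
        6 * ![0, a, b, c, e, f] j + j < 6 * ![0, a, b, c, e, f] i + i + 6 := by
  have hadd : (∀ i j : Fin 6, ![0, a, b, c, e, f] (i + j) ≤ ![0, a, b, c, e, f] i +
      ![0, a, b, c, e, f] j + ((i : ℕ) + j) / 6) ↔
      (b ≤ a + a ∧ c ≤ a + b ∧ e ≤ a + c ∧ f ≤ a + e ∧ e ≤ b + b ∧ f ≤ b + c ∧
        a ≤ b + f + 1 ∧ a ≤ c + e + 1 ∧ b ≤ c + f + 1 ∧ b ≤ e + e + 1 ∧ c ≤ e + f + 1 ∧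
        e ≤ f + f + 1) := by
    constructor
    · intro h
      exact ⟨h 1 1, h 1 2, h 1 3, h 1 4, h 2 2, h 2 3, h 2 5, h 3 4, h 3 5, h 4 4, h 4 5,
        h 5 5⟩
    · intro h i j
      fin_cases i <;> fin_cases j <;> simp [Fin.add_def] <;> omega
  have hne : (∀ i : Fin 6, i ≠ 0 → ![0, a, b, c, e, f] i ≠ 0) ↔
      (a ≠ 0 ∧ b ≠ 0 ∧ c ≠ 0 ∧ e ≠ 0 ∧ f ≠ 0) := by
    simp [Fin.forall_fin_succ]
  have hsum : ∑ i, ![0, a, b, c, e, f] i = a + b + c + e + f := by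
    simp [Fin.sum_univ_six]
  rw [kunzTuples, Set.mem_ofPred_eq, hadd, hne, hsum]
  simp

theorem eq_cons_of_mem_kunzTuples {d g : ℕ} {k : Fin 6 → ℕ} (hk : k ∈ kunzTuples d g) :
    k = ![0, k 1, k 2, k 3, k 4, k 5] := by
  ext i
  fin_cases i
  · exact hk.1
  all_goals rfl

/-- The Kunz coordinates `x` and `y` of the residues `2` and `4`, for the semigroups of genus `g`
and multiplicity `6` all of whose elements below the conductor are even. -/
def evenPairs (g : ℕ) : Finset (ℕ × ℕ) :=
  (Finset.Icc 1 g ×ˢ Finset.Icc 1 g).filter fun p =>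
    p.2 ≤ 2 * p.1 ∧ p.1 ≤ 2 * p.2 + 1 ∧ 4 * p.1 + p.2 ≤ g + 2 ∧ p.1 + 4 * p.2 ≤ g + 1

/-- The odd classes satisfy k₁ ≥ k₃ ≥ k₅ ≥ k₁ − 1, so their sum g − x − y determines them. The last
two bounds in `evenPairs` are x ≤ k₁ and y ≤ k₃; the other conditions involving odd classes then
follow. -/
theorem kunzTuples_two_eq {g : ℕ} (hg : 5 ≤ g) : kunzTuples 2 g =
    (fun p : ℕ × ℕ => ![0, (g - p.1 - p.2 + 2) / 3, p.1, (g - p.1 - p.2 + 1) / 3, p.2,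
      (g - p.1 - p.2) / 3]) '' ↑(evenPairs g) := by
  ext k
  simp only [Set.mem_image, Finset.mem_coe, evenPairs, Finset.mem_filter, Finset.mem_product,
    Finset.mem_Icc, Prod.exists]
  constructor
  · intro hk
    have hk' := hk
    rw [eq_cons_of_mem_kunzTuples hk, mem_kunzTuples_iff] at hk'
    obtain ⟨hne, hadd, hsum, h⟩ := hk'
    have h12 := h 1 2 (by decide)
    have h13 := h 1 3 (by decide)
    have h14 := h 1 4 (by decide)
    have h15 := h 1 5 (by decide)
    have h31 := h 3 1 (by decide)
    have h32 := h 3 2 (by decide)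
    have h34 := h 3 4 (by decide)
    have h35 := h 3 5 (by decide)
    have h51 := h 5 1 (by decide)
    have h52 := h 5 2 (by decide)
    have h53 := h 5 3 (by decide)
    have h54 := h 5 4 (by decide)
    simp at h12 h13 h14 h15 h31 h32 h34 h35 h51 h52 h53 h54
    refine ⟨k 2, k 4, by omega, ?_⟩
    have h1 : (g - k 2 - k 4 + 2) / 3 = k 1 := by omega
    have h3 : (g - k 2 - k 4 + 1) / 3 = k 3 := by omega
    have h5 : (g - k 2 - k 4) / 3 = k 5 := by omega
    rw [h1, h3, h5, ← eq_cons_of_mem_kunzTuples hk]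
  · rintro ⟨x, y, h, rfl⟩
    rw [mem_kunzTuples_iff]
    refine ⟨by omega, by omega, by omega, fun i j hi => ?_⟩
    fin_cases i <;> simp at hi <;> fin_cases j <;> simp <;> omega

theorem ncard_kunzTuples_two {g : ℕ} (hg : 5 ≤ g) :
    (kunzTuples 2 g).ncard = (evenPairs g).card := by
  rw [kunzTuples_two_eq hg, Set.ncard_image_of_injective, Set.ncard_coe_finset]
  rintro ⟨x, y⟩ ⟨x', y'⟩ h
  exact Prod.ext (congrFun h 2) (congrFun h 4)

/-- Only x = k₃ is free; its binding upper bound x ≤ k₂ becomes 5x ≤ g + 2. -/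
theorem kunzTuples_three_eq {g : ℕ} (hg : 5 ≤ g) : kunzTuples 3 g =
    (fun x => ![0, (g - x + 3) / 4, (g - x + 2) / 4, x, (g - x + 1) / 4, (g - x) / 4]) ''
      ↑(Finset.Icc 1 ((g + 2) / 5)) := by
  ext k
  simp only [Set.mem_image, Finset.mem_coe, Finset.mem_Icc]
  constructor
  · intro hk
    have hk' := hk
    rw [eq_cons_of_mem_kunzTuples hk, mem_kunzTuples_iff] at hk'
    obtain ⟨hne, hadd, hsum, h⟩ := hk'
    have h12 := h 1 2 (by decide)
    have h13 := h 1 3 (by decide)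
    have h14 := h 1 4 (by decide)
    have h15 := h 1 5 (by decide)
    have h21 := h 2 1 (by decide)
    have h23 := h 2 3 (by decide)
    have h24 := h 2 4 (by decide)
    have h25 := h 2 5 (by decide)
    have h41 := h 4 1 (by decide)
    have h42 := h 4 2 (by decide)
    have h43 := h 4 3 (by decide)
    have h45 := h 4 5 (by decide)
    have h51 := h 5 1 (by decide)
    have h52 := h 5 2 (by decide)
    have h53 := h 5 3 (by decide)
    have h54 := h 5 4 (by decide)
    simp at h12 h13 h14 h15 h21 h23 h24 h25 h41 h42 h43 h45 h51 h52 h53 h54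
    refine ⟨k 3, by omega, ?_⟩
    have h1 : (g - k 3 + 3) / 4 = k 1 := by omega
    have h2 : (g - k 3 + 2) / 4 = k 2 := by omega
    have h4 : (g - k 3 + 1) / 4 = k 4 := by omega
    have h5 : (g - k 3) / 4 = k 5 := by omega
    rw [h1, h2, h4, h5, ← eq_cons_of_mem_kunzTuples hk]
  · rintro ⟨x, h, rfl⟩
    rw [mem_kunzTuples_iff]
    refine ⟨by omega, by omega, by omega, fun i j hi => ?_⟩
    fin_cases i <;> simp at hi <;> fin_cases j <;> simp <;> omega

theorem ncard_kunzTuples_three {g : ℕ} (hg : 5 ≤ g) :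
    (kunzTuples 3 g).ncard = (g + 2) / 5 := by
  rw [kunzTuples_three_eq hg, Set.ncard_image_of_injective, Set.ncard_coe_finset]
  · simp
  · exact fun x x' h => congrFun h 3

theorem ncard_kunzTuples_six {g : ℕ} (hg : 5 ≤ g) : (kunzTuples 6 g).ncard = 1 := by
  refine Set.ncard_eq_one.2
    ⟨![0, (g + 4) / 5, (g + 3) / 5, (g + 2) / 5, (g + 1) / 5, g / 5], ?_⟩
  ext k
  rw [Set.mem_singleton_iff]
  constructor
  · intro hk
    have hk' := hk
    rw [eq_cons_of_mem_kunzTuples hk, mem_kunzTuples_iff] at hk'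
    obtain ⟨hne, hadd, hsum, h⟩ := hk'
    have h12 := h 1 2 (by decide)
    have h23 := h 2 3 (by decide)
    have h34 := h 3 4 (by decide)
    have h45 := h 4 5 (by decide)
    have h51 := h 5 1 (by decide)
    simp at h12 h23 h34 h45 h51
    clear hadd h hne
    have h1 : (g + 4) / 5 = k 1 := by omega
    have h2 : (g + 3) / 5 = k 2 := by omega
    have h3 : (g + 2) / 5 = k 3 := by omega
    have h4 : (g + 1) / 5 = k 4 := by omega
    have h5 : g / 5 = k 5 := by omega
    rw [h1, h2, h3, h4, h5, ← eq_cons_of_mem_kunzTuples hk]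
  · rintro rfl
    -- These linear facts are all that is needed about the quotients, which are then made opaque.
    obtain ⟨hab, hbc, hce, hef, hfa, hf, hsum⟩ : (g + 3) / 5 ≤ (g + 4) / 5 ∧
        (g + 2) / 5 ≤ (g + 3) / 5 ∧ (g + 1) / 5 ≤ (g + 2) / 5 ∧ g / 5 ≤ (g + 1) / 5 ∧
        (g + 4) / 5 ≤ g / 5 + 1 ∧ 1 ≤ g / 5 ∧
        (g + 4) / 5 + (g + 3) / 5 + (g + 2) / 5 + (g + 1) / 5 + g / 5 = g := by omega
    generalize (g + 4) / 5 = a, (g + 3) / 5 = b, (g + 2) / 5 = c, (g + 1) / 5 = e,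
      g / 5 = f at *
    rw [mem_kunzTuples_iff]
    refine ⟨by omega, by omega, hsum, fun i j hi => ?_⟩
    fin_cases i <;> simp at hi <;> fin_cases j <;> simp <;> omega

theorem chainCount_six_eq {g : ℕ} (hg : 5 ≤ g) :
    chainCount 6 g + 1 = (evenPairs g).card + (g + 2) / 5 := by
  rw [← ncard_kunzTuples_six hg, chainCount_six_add, ncard_kunzTuples_two hg,
    ncard_kunzTuples_three hg]

theorem chainCount_six_of_le {g : ℕ} (hg : g ≤ 4) : chainCount 6 g = 0 := by
  have h : ∀ d, kunzTuples d g = ∅ := fun d => by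
    refine Set.eq_empty_of_forall_notMem fun k hk => ?_
    rw [eq_cons_of_mem_kunzTuples hk, mem_kunzTuples_iff] at hk
    omega
  simpa [h] using chainCount_six_add g

end NumericalSemigroup

/-! ### Floor sums as sums of minima -/

theorem sum_Icc_one_natCast (f : ℤ → ℤ) (m : ℕ) :
    ∑ n ∈ Finset.Icc 1 (m : ℤ), f n = ∑ i ∈ Finset.range m, f (i + 1) := by
  induction m with
  | zero => simp
  | succ m ih =>
    have : Finset.Icc 1 ((m + 1 : ℕ) : ℤ) = insert ((m : ℤ) + 1) (Finset.Icc 1 (m : ℤ)) := by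
      ext n
      simp only [Finset.mem_insert, Finset.mem_Icc]
      omega
    rw [Finset.sum_range_succ, ← ih, this, Finset.sum_insert (by simp), add_comm]

/-- A sum of minima splits at the point where the two functions cross. -/
theorem sum_id_add_sum_eq_sum_min {p q : ℤ} (f : ℤ → ℤ) (hp : 0 ≤ p) (hpq : p ≤ q)
    (hle : ∀ n ≤ p, n ≤ f n) (hge : ∀ n, p < n → f n ≤ n) :
    ∑ n ∈ Finset.Icc 1 p, n + ∑ n ∈ Finset.Icc (p + 1) q, f n =
      ∑ n ∈ Finset.Icc 1 q, min n (f n) := by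
  have hunion : Finset.Icc 1 q = Finset.Icc 1 p ∪ Finset.Icc (p + 1) q := by
    ext n
    simp only [Finset.mem_union, Finset.mem_Icc]
    omega
  have hdisj : Disjoint (Finset.Icc 1 p) (Finset.Icc (p + 1) q) := by
    rw [Finset.disjoint_left]
    intro n
    simp only [Finset.mem_Icc]
    omega
  rw [hunion, Finset.sum_union hdisj]
  congr 1
  · refine Finset.sum_congr rfl fun n hn => ?_
    rw [min_eq_left (hle n (Finset.mem_Icc.1 hn).2)]
  · refine Finset.sum_congr rfl fun n hn => ?_
    rw [min_eq_right (hge n (by have := (Finset.mem_Icc.1 hn).1; omega))]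

/-- The crossing point comes from n ≤ ⌊(g−11−5n)/4⌋ iff 9n ≤ g − 11, and likewise with 8 in place of
11. -/
theorem sixFloorSums_eq {g : ℤ} (hg : 16 ≤ g) : sixFloorSums g =
    ∑ n ∈ Finset.Icc 1 ((g - 15) / 5), min n ((g - 11 - 5 * n) / 4) +
      ∑ n ∈ Finset.Icc 1 ((g - 12) / 5), min n ((g - 8 - 5 * n) / 4) := by
  rw [← sum_id_add_sum_eq_sum_min (p := (g - 11) / 9) _ (by omega) (by omega)
      (fun n hn => by omega) (fun n hn => by omega),
    ← sum_id_add_sum_eq_sum_min (p := (g - 8) / 9) _ (by omega) (by omega)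
      (fun n hn => by omega) (fun n hn => by omega), sixFloorSums]
  have h1 : (g - 11) / 9 + 1 = (g - 2) / 9 := by omega
  have h2 : (g - 8) / 9 + 1 = (g + 1) / 9 := by omega
  rw [h1, h2]
  ring

/-! ### Counting the even pairs -/

namespace NumericalSemigroup

/-- Slice by k = min(x, y): one diagonal point, then the points (k + j, k) and (k, k + j) with j ≥
1, each family cut off by one doubling bound and one genus bound. -/
theorem card_evenPairs (g : ℕ) : (evenPairs g).card = ∑ k ∈ Finset.Icc 1 ((g + 1) / 5),
    (1 + min (k + 1) ((g + 2 - 5 * k) / 4) + min k ((g + 1 - 5 * k) / 4)) := by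
  have hsigma := Finset.card_sigma (Finset.Icc 1 ((g + 1) / 5)) fun k => Finset.range
    (1 + min (k + 1) ((g + 2 - 5 * k) / 4) + min k ((g + 1 - 5 * k) / 4))
  simp only [Finset.card_range] at hsigma
  rw [← hsigma]
  -- Within a slice, offsets up to the first minimum encode x − y ≥ 0; larger ones encode y − x > 0.
  refine Finset.card_nbij'
    (fun p => ⟨min p.1 p.2, if p.2 ≤ p.1 then p.1 - p.2 else
      min (p.1 + 1) ((g + 2 - 5 * p.1) / 4) + (p.2 - p.1)⟩)
    (fun s => if s.2 ≤ min (s.1 + 1) ((g + 2 - 5 * s.1) / 4) then (s.1 + s.2, s.1) else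
      (s.1, s.1 + (s.2 - min (s.1 + 1) ((g + 2 - 5 * s.1) / 4)))) ?_ ?_ ?_ ?_
  · rintro ⟨x, y⟩ h
    simp only [evenPairs, Finset.coe_filter, Set.mem_ofPred_eq, Finset.mem_product,
      Finset.mem_Icc, Finset.mem_coe, Finset.mem_sigma, Finset.mem_range] at h ⊢
    split_ifs with hxy
    · rw [min_eq_right hxy]
      omega
    · rw [min_eq_left (by omega)]
      omega
  · rintro ⟨k, j⟩ h
    simp only [evenPairs, Finset.coe_filter, Set.mem_ofPred_eq, Finset.mem_product,
      Finset.mem_Icc, Finset.mem_coe, Finset.mem_sigma, Finset.mem_range] at h ⊢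
    split_ifs with hj
    · simp only
      omega
    · simp only
      omega
  · rintro ⟨x, y⟩ h
    simp only [evenPairs, Finset.coe_filter, Set.mem_ofPred_eq, Finset.mem_product,
      Finset.mem_Icc] at h
    by_cases hxy : y ≤ x
    · simp only [hxy, if_true, min_eq_right]
      rw [if_pos (by omega), Prod.mk.injEq]
      omega
    · simp only [hxy, if_false, min_eq_left (not_le.1 hxy).le]
      rw [if_neg (by omega), Prod.mk.injEq]
      omega
  · rintro ⟨k, j⟩ h
    simp only [Finset.mem_coe, Finset.mem_sigma, Finset.mem_Icc, Finset.mem_range] at h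
    by_cases hj : j ≤ min (k + 1) ((g + 2 - 5 * k) / 4)
    · simp only [hj, if_true]
      rw [min_eq_right (by omega), if_pos (by omega)]
      congr 1
      omega
    · simp only [hj, if_false]
      rw [min_eq_left (by omega), if_neg (by omega)]
      congr 1
      omega

theorem cast_card_evenPairs (g : ℕ) : ((evenPairs g).card : ℤ) =
    ((g + 1) / 5 : ℕ) +
      ∑ i ∈ Finset.range ((g + 1) / 5), min ((i : ℤ) + 2) (((g : ℤ) - 3 - 5 * i) / 4) +
      ∑ i ∈ Finset.range ((g + 1) / 5), min ((i : ℤ) + 1) (((g : ℤ) - 4 - 5 * i) / 4) := by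
  have hIcc : Finset.Icc 1 ((g + 1) / 5) = (Finset.range ((g + 1) / 5)).image (· + 1) := by
    ext k
    simp only [Finset.mem_Icc, Finset.mem_image, Finset.mem_range]
    exact ⟨fun h => ⟨k - 1, by omega, by omega⟩, by rintro ⟨i, hi, rfl⟩; omega⟩
  rw [card_evenPairs, hIcc, Finset.sum_image fun _ _ _ _ h => Nat.succ_injective h,
    Nat.cast_sum]
  have : (((g + 1) / 5 : ℕ) : ℤ) = ∑ i ∈ Finset.range ((g + 1) / 5), (1 : ℤ) := by simp
  rw [this, ← Finset.sum_add_distrib, ← Finset.sum_add_distrib]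
  refine Finset.sum_congr rfl fun i hi => ?_
  rw [Finset.mem_range] at hi
  omega

/-- Split off the term at 0, which is 2, and take 2 out of each later minimum, that is 8 out of the
numerator. -/
theorem sum_range_min_add_two {g : ℤ} (hg : 11 ≤ g) (n : ℕ) :
    ∑ i ∈ Finset.range (n + 1), min ((i : ℤ) + 2) ((g - 3 - 5 * i) / 4) =
      2 + 2 * n + ∑ i ∈ Finset.range n, min ((i : ℤ) + 1) ((g - 11 - 5 * (i + 1)) / 4) := by
  have h2 : (2 * n : ℤ) = ∑ i ∈ Finset.range n, (2 : ℤ) := by simp [mul_comm]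
  rw [Finset.sum_range_succ', h2, add_assoc 2, ← Finset.sum_add_distrib, add_comm]
  congr 1
  · omega
  · exact Finset.sum_congr rfl fun i _ => by omega

theorem sum_range_min_add_one {g : ℤ} (hg : 8 ≤ g) (n : ℕ) :
    ∑ i ∈ Finset.range (n + 1), min ((i : ℤ) + 1) ((g - 4 - 5 * i) / 4) =
      1 + n + ∑ i ∈ Finset.range n, min ((i : ℤ) + 1) ((g - 8 - 5 * (i + 1)) / 4) := by
  have h1 : (n : ℤ) = ∑ i ∈ Finset.range n, (1 : ℤ) := by simp
  rw [Finset.sum_range_succ', h1, add_assoc 1, ← Finset.sum_add_distrib, add_comm]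
  congr 1
  · omega
  · exact Finset.sum_congr rfl fun i _ => by omega

theorem cast_chainCount_six {g : ℕ} (hg : 16 ≤ g) : (chainCount 6 g : ℤ) =
    (if g % 5 ≤ 2 then (g : ℤ) - 5 else (g : ℤ) - 4) + sixFloorSums g := by
  obtain ⟨m, hm⟩ : ∃ m, m = (g - 15) / 5 := ⟨_, rfl⟩
  have hcount := chainCount_six_eq (g := g) (by omega)
  have hcard := cast_card_evenPairs g
  have hU := sum_range_min_add_two (g := g) (by omega) m
  have h1 : ((g : ℤ) - 15) / 5 = (m : ℕ) := by omega
  have h2 : ((g : ℤ) - 12) / 5 = ((g - 12) / 5 : ℕ) := by omega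
  rw [sixFloorSums_eq (by omega), h1, h2, sum_Icc_one_natCast, sum_Icc_one_natCast]
  have hV := sum_range_min_add_one (g := g) (by omega) ((g - 12) / 5)
  have hNU : (g + 1) / 5 = m + 1 + 2 ∨ (g + 1) / 5 = m + 1 + 3 := by omega
  have hNV : (g + 1) / 5 = (g - 12) / 5 + 1 + 1 ∨ (g + 1) / 5 = (g - 12) / 5 + 1 + 2 := by omega
  -- Beyond index `m` the quotient is the minimum. Two terms remain, and a third, if present, is 0;
  -- the next sum similarly keeps one.
  have htU : ∑ i ∈ Finset.range ((g + 1) / 5), min ((i : ℤ) + 2) (((g : ℤ) - 3 - 5 * i) / 4) =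
      ∑ i ∈ Finset.range (m + 1), min ((i : ℤ) + 2) (((g : ℤ) - 3 - 5 * i) / 4) +
        ((g : ℤ) - 8 - 5 * m) / 4 + ((g : ℤ) - 13 - 5 * m) / 4 := by
    rcases hNU with hN | hN <;> rw [hN] <;>
      rw [Finset.sum_range_add _ (m + 1)] <;> simp only [Finset.sum_range_succ,
        Finset.sum_range_zero] <;> omega
  have htV : ∑ i ∈ Finset.range ((g + 1) / 5), min ((i : ℤ) + 1) (((g : ℤ) - 4 - 5 * i) / 4) =
      ∑ i ∈ Finset.range ((g - 12) / 5 + 1), min ((i : ℤ) + 1) (((g : ℤ) - 4 - 5 * i) / 4) +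
        ((g : ℤ) - 9 - 5 * ((g - 12) / 5 : ℕ)) / 4 := by
    rcases hNV with hN | hN <;> rw [hN] <;>
      rw [Finset.sum_range_add _ ((g - 12) / 5 + 1)] <;> simp only [Finset.sum_range_succ,
        Finset.sum_range_zero] <;> omega
  rw [htU, htV, hU, hV] at hcard
  split_ifs <;> omega

end NumericalSemigroup

theorem mainTheorem5 (g : ℕ) :
    (NumericalSemigroup.chainSemigroups 6 g).Finite ∧
    (g ≤ 4 → NumericalSemigroup.chainCount 6 g = 0) ∧
    (g = 5 → NumericalSemigroup.chainCount 6 g = 1) ∧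
    (5 < g → g ≤ 15 → g % 5 ≤ 2 →
      (NumericalSemigroup.chainCount 6 g : ℤ) = (g : ℤ) - 5) ∧
    (5 < g → g ≤ 15 → 2 < g % 5 →
      (NumericalSemigroup.chainCount 6 g : ℤ) = (g : ℤ) - 4) ∧
    (16 ≤ g → g % 5 ≤ 2 →
      (NumericalSemigroup.chainCount 6 g : ℤ) = (g : ℤ) - 5 + sixFloorSums g) ∧
    (16 ≤ g → 2 < g % 5 →
      (NumericalSemigroup.chainCount 6 g : ℤ) = (g : ℤ) - 4 + sixFloorSums g) := by
  have hsmall : 5 ≤ g → g ≤ 15 → NumericalSemigroup.chainCount 6 g + 1 =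
      if g = 5 then 2 else if g % 5 ≤ 2 then g - 4 else g - 3 := by
    intro h5 h15
    rw [NumericalSemigroup.chainCount_six_eq h5, NumericalSemigroup.card_evenPairs]
    -- The finitely many small genera are evaluated directly; `g = 5` is exceptional.
    interval_cases g <;> rfl
  refine ⟨NumericalSemigroup.finite_chainSemigroups_six g,
    NumericalSemigroup.chainCount_six_of_le, fun h => ?_, fun h h' hmod => ?_,
    fun h h' hmod => ?_, fun h hmod => ?_, fun h hmod => ?_⟩
  · have := hsmall (by omega) (by omega)
    rw [if_pos h] at this
    omega
  · have := hsmall (by omega) h'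
    rw [if_neg (by omega), if_pos hmod] at this
    omega
  · have := hsmall (by omega) h'
    rw [if_neg (by omega), if_neg (by omega)] at this
    omega
  · rw [NumericalSemigroup.cast_chainCount_six h, if_pos hmod]
  · rw [NumericalSemigroup.cast_chainCount_six h, if_neg (by omega)]
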